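/- Let $A$ be the discrete free Schrödinger operator on $l^2(\mathbb{Z})$, that is, $(Au)(k)=u(k-1)+u(k+1)$ for $u\in l^2(\mathbb{Z})$ and $k\in\mathbb{Z}$. For a bounded operator $B$ on $l^2(\mathbb{Z})$, let $\sigma_{disc}(B)$ denote the discrete spectrum of $B$, i.e. the set of those eigenvalues of $B$ that are isolated points of the spectrum $\sigma(B)$ and have finite algebraic multiplicity (the algebraic multiplicity of an isolated eigenvalue being the rank of the associated Riesz projection). Let $\{\lambda_k\}_{k\in\mathbb{N}}\subset\mathbb{C}\setminus[-2,2]$ be any sequence which satisfies $$\sum_{k}\frac{\operatorname{dist}(\lambda_k,[-2,2])}{|\lambda_k+2|^{1/2}\,|\lambda_k-2|^{1/2}}<\infty .$$ Then there exists a bounded operator $M$ on $l^2(\mathbb{Z})$ of rank one such that, setting $B=A+M$, we have $\{\lambda_k\}_{k\in\mathbb{N}}\subset\sigma_{disc}(B)$. -/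

import Mathlib

noncomputable section

/-- The complex Hilbert space `l²(ℤ)`. -/
abbrev EllTwoZ : Type := lp (fun _ : ℤ => ℂ) 2

/-- The translate `k ↦ u (k + a)` of a square-summable sequence is square-summable. -/
theorem memlp_shiftBy (a : ℤ) (u : EllTwoZ) :
    Memℓp (fun k : ℤ => (u : ℤ → ℂ) (k + a)) 2 := by
  have h := (memℓp_gen_iff (p := 2) (by norm_num)).1 (lp.memℓp u)
  exact memℓp_gen ((Equiv.addRight a).summable_iff.2 h)

/-- Translation `(T_a u)(k) = u (k + a)` as a linear isometry of `l²(ℤ)`. -/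
def shiftBy (a : ℤ) : EllTwoZ →ₗᵢ[ℂ] EllTwoZ where
  toFun u := ⟨fun k : ℤ => (u : ℤ → ℂ) (k + a), memlp_shiftBy a u⟩
  map_add' _ _ := rfl
  map_smul' _ _ := rfl
  norm_map' u := by
    have h2 : 0 < (2 : ENNReal).toReal := by norm_num
    rw [lp.norm_eq_tsum_rpow h2, lp.norm_eq_tsum_rpow h2]
    congr 1
    exact (Equiv.addRight a).tsum_eq fun k => ‖(u : ℤ → ℂ) k‖ ^ (2 : ENNReal).toReal

/-- The discrete free Schrödinger operator `(A u)(k) = u(k - 1) + u(k + 1)` on `l²(ℤ)`. -/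
def freeSchrodinger : EllTwoZ →L[ℂ] EllTwoZ :=
  (shiftBy (-1)).toContinuousLinearMap + (shiftBy 1).toContinuousLinearMap

theorem freeSchrodinger_apply (u : EllTwoZ) (k : ℤ) :
    (freeSchrodinger u : ℤ → ℂ) k = (u : ℤ → ℂ) (k - 1) + (u : ℤ → ℂ) (k + 1) := rfl

section DiscreteSpectrum

variable {H : Type*} [NormedAddCommGroup H] [NormedSpace ℂ H]

/-- The Riesz operator `(2πi)⁻¹ ∮_{|z - μ| = r} (z - B)⁻¹ dz`. If `μ` is an isolated point of the
spectrum of `B` and `r` is so small that no other spectral point lies in the closed disc, this is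
the Riesz spectral projection of `B` at `μ`, whose rank is the algebraic multiplicity of `μ`. -/
def rieszProjection (B : H →L[ℂ] H) (μ : ℂ) (r : ℝ) : H →L[ℂ] H :=
  (2 * Real.pi * Complex.I : ℂ)⁻¹ • ∮ z in C(μ, r), resolvent B z

/-- The discrete spectrum of a bounded operator: the eigenvalues that are isolated from the rest of
the spectrum and have finite algebraic multiplicity (the Riesz projection has finite rank). -/
def discreteSpectrum (B : H →L[ℂ] H) : Set ℂ :=
  {μ : ℂ | Module.End.HasEigenvalue (B : H →ₗ[ℂ] H) μ ∧
    ∃ r : ℝ, 0 < r ∧ Metric.closedBall μ r ∩ spectrum ℂ B = {μ} ∧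
      FiniteDimensional ℂ (LinearMap.range (rieszProjection B μ r : H →ₗ[ℂ] H))}

end DiscreteSpectrum

/-- The real interval `[-2, 2]` as a subset of the complex plane. -/
def bandInterval : Set ℂ := Complex.ofReal '' Set.Icc (-2 : ℝ) 2

end

/-! ### Discrete spectrum of rank-one perturbations. -/

section RankOnePerturbation

open Metric Filter Topology

variable {H : Type*} [NormedAddCommGroup H] [NormedSpace ℂ H]

/-! Under `λ = z + z⁻¹` the punctured unit disc covers the complement of `[-2, 2]`, and the
summability hypothesis yields the Blaschke condition `∑ (1 - |z k|) < ∞`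
(`one_sub_norm_le_of_joukowski`). Hence some bounded analytic `b` on the disc has `b 0 = 1` and
vanishes at every `z k` (`exists_bounded_analytic_vanishing`), and its Taylor coefficients are
square-summable (`summable_sq_norm_of_bounded`).

Let `α` carry these coefficients on the positive integers, `e` be evaluation at `0` and `ψ = α(· -
1) - α(· + 1)`. The difference cancels the denominator `z⁻¹ - z` of the free Green function, so the
perturbation determinant of `A` and `A + e ⊗ ψ` at `z + z⁻¹` is exactly `b z`
(`perturbationDet_freeSchrodinger`). A zero of this determinant in the resolvent set of `A`, near
which it is not identically zero, is a discrete eigenvalue of the perturbed operator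
(`mem_discreteSpectrum_add_smulRight`). -/

theorem sub_mul_resolvent {B : H →L[ℂ] H} {μ z : ℂ} (hz : z ∈ resolventSet ℂ B) :
    (B - algebraMap ℂ _ μ) * resolvent B z = (z - μ) • resolvent B z - 1 := by
  have h : (algebraMap ℂ (H →L[ℂ] H) z - B) * resolvent B z = 1 :=
    Ring.mul_inverse_cancel _ hz
  rw [← h, sub_mul, sub_mul, Algebra.algebraMap_eq_smul_one, Algebra.algebraMap_eq_smul_one,
    smul_mul_assoc, smul_mul_assoc, one_mul, sub_smul]
  abel

/-- The subtracted sum is polynomial in `z`, so it does not contribute to contour integrals. -/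
theorem sub_pow_mul_resolvent {B : H →L[ℂ] H} {μ z : ℂ} (hz : z ∈ resolventSet ℂ B) (m : ℕ) :
    (B - algebraMap ℂ _ μ) ^ m * resolvent B z = (z - μ) ^ m • resolvent B z -
      ∑ j ∈ Finset.range m, (z - μ) ^ j • (B - algebraMap ℂ _ μ) ^ (m - 1 - j) := by
  induction m with
  | zero => simp
  | succ m ih =>
    rw [pow_succ', mul_assoc, ih, mul_sub, mul_smul_comm, sub_mul_resolvent hz, smul_sub,
      smul_smul, ← pow_succ, Finset.sum_range_succ, Finset.mul_sum, sub_sub,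
      add_comm ((z - μ) ^ m • (1 : H →L[ℂ] H))]
    congr 2
    · refine Finset.sum_congr rfl fun j hj => ?_
      have hj := Finset.mem_range.1 hj
      rw [mul_smul_comm, ← pow_succ', show m - 1 - j + 1 = m + 1 - 1 - j by omega]
    · simp

theorem finiteDimensional_ker_pow {f : Module.End ℂ H}
    (hf : FiniteDimensional ℂ (LinearMap.ker f)) (m : ℕ) :
    FiniteDimensional ℂ (LinearMap.ker (f ^ m)) := by
  induction m with
  | zero =>
    rw [pow_zero, Module.End.one_eq_id, LinearMap.ker_id]
    infer_instance
  | succ m ih =>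
    rw [pow_succ, Module.End.mul_eq_comp, LinearMap.ker_comp]
    infer_instance

/-- The perturbation determinant `1 - e ((z - A)⁻¹ ψ)` of `A` and `A + e ⊗ ψ`. -/
noncomputable def perturbationDet (A : H →L[ℂ] H) (e : H →L[ℂ] ℂ) (ψ : H) (z : ℂ) : ℂ :=
  1 - e (resolvent A z ψ)

variable {A : H →L[ℂ] H} {e : H →L[ℂ] ℂ} {ψ : H}

/-- Sherman-Morrison formula for the resolvent. -/
theorem resolvent_add_smulRight {z : ℂ} (hz : z ∈ resolventSet ℂ A)
    (hD : perturbationDet A e ψ z ≠ 0) :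
    z ∈ resolventSet ℂ (A + e.smulRight ψ) ∧
    resolvent (A + e.smulRight ψ) z = resolvent A z + (perturbationDet A e ψ z)⁻¹ •
      (resolvent A z * e.smulRight ψ * resolvent A z) := by
  set R := resolvent A z with hR
  set T : H →L[ℂ] H := e.smulRight ψ with hT
  set c := perturbationDet A e ψ z with hc
  set L : H →L[ℂ] H := algebraMap ℂ _ z - A with hL
  have h1 : L * R = 1 := Ring.mul_inverse_cancel _ hz
  have h2 : R * L = 1 := Ring.inverse_mul_cancel _ hz
  -- Rank one makes `T R T` a multiple of `T`, so the Neumann series collapses to a single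
  -- correction term.
  have hTRT : T * R * T = (1 - c) • T := by
    ext x
    simp [hT, hc, perturbationDet, ← hR, mul_comm, smul_smul]
  have hLT : algebraMap ℂ (H →L[ℂ] H) z - (A + T) = L - T := by rw [hL]; abel
  have h3 : (L - T) * (R + c⁻¹ • (R * T * R)) = 1 := by
    have : (L - T) * (R + c⁻¹ • (R * T * R)) =
        L * R - T * R + c⁻¹ • ((L * R) * T * R - T * R * T * R) := by
      rw [sub_mul, mul_add, mul_add, mul_smul_comm, mul_smul_comm, smul_sub]
      simp only [mul_assoc]
      abel
    rw [this, h1, hTRT, one_mul, smul_mul_assoc, sub_smul, one_smul, sub_sub_cancel, smul_smul,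
      inv_mul_cancel₀ hD, one_smul]
    abel
  have h4 : (R + c⁻¹ • (R * T * R)) * (L - T) = 1 := by
    have : (R + c⁻¹ • (R * T * R)) * (L - T) =
        R * L - R * T + c⁻¹ • (R * T * (R * L) - R * (T * R * T)) := by
      rw [mul_sub, add_mul, add_mul, smul_mul_assoc, smul_mul_assoc, smul_sub]
      simp only [mul_assoc]
      abel
    rw [this, h2, hTRT, mul_one, mul_smul_comm, sub_smul, one_smul, sub_sub_cancel, smul_smul,
      inv_mul_cancel₀ hD, one_smul]
    abel
  let u : (H →L[ℂ] H)ˣ := ⟨L - T, R + c⁻¹ • (R * T * R), h3, h4⟩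
  have hu : algebraMap ℂ (H →L[ℂ] H) z - (A + T) = u := hLT
  refine ⟨?_, ?_⟩
  · rw [spectrum.mem_resolventSet_iff, hu]
    exact u.isUnit
  · rw [resolvent, hu, Ring.inverse_unit]
    rfl

variable [CompleteSpace H]

/-- If the resolvent of `B` has at most a pole at `μ` and the eigenspace is finite-dimensional, then
so is the range of the Riesz projection. -/
theorem finiteDimensional_range_rieszProjection {B : H →L[ℂ] H} {μ : ℂ} {r : ℝ} (hr : 0 < r)
    (hB : ∀ z ∈ closedBall μ r, z ≠ μ → z ∈ resolventSet ℂ B)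
    (hker : FiniteDimensional ℂ (LinearMap.ker ((B - algebraMap ℂ _ μ : H →L[ℂ] H) : H →ₗ[ℂ] H)))
    (m : ℕ) (K : ℂ → H →L[ℂ] H) (hKc : ContinuousOn K (closedBall μ r))
    (hKd : ∀ z ∈ ball μ r, z ≠ μ → DifferentiableAt ℂ K z)
    (hK : ∀ z ∈ closedBall μ r, z ≠ μ → K z = (z - μ) ^ m • resolvent B z) :
    FiniteDimensional ℂ (LinearMap.range (rieszProjection B μ r : H →ₗ[ℂ] H)) := by
  set N : H →L[ℂ] H := B - algebraMap ℂ _ μ with hN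
  have hne : ∀ z ∈ sphere μ r, z ≠ μ := fun z hz => ne_of_mem_sphere hz hr.ne'
  have hres : ContinuousOn (resolvent B) (sphere μ r) := fun z hz =>
    (spectrum.hasDerivAt_resolvent_const_left
      (hB z (sphere_subset_closedBall hz) (hne z hz))).continuousAt.continuousWithinAt
  have hint : CircleIntegrable (resolvent B) μ r := hres.circleIntegrable hr.le
  -- Cauchy's theorem with the centre as exceptional point: the integrand is `K` minus a polynomial.
  -- Thus the Riesz projection maps into `ker (N ^ m)`.
  have hzero : N ^ m * (∮ z in C(μ, r), resolvent B z) = 0 := by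
    have h1 : N ^ m * (∮ z in C(μ, r), resolvent B z) =
        ∮ z in C(μ, r), N ^ m * resolvent B z := by
      have h := ContinuousLinearMap.intervalIntegral_comp_comm
        (ContinuousLinearMap.mul ℂ (H →L[ℂ] H) (N ^ m)) hint.out
      simp only [circleIntegral]
      refine h.symm.trans ?_
      exact intervalIntegral.integral_congr fun θ _ => mul_smul_comm _ _ _
    have h2 : (∮ z in C(μ, r), N ^ m * resolvent B z) = ∮ z in C(μ, r),
        (K z - ∑ j ∈ Finset.range m, (z - μ) ^ j • N ^ (m - 1 - j)) := by
      refine circleIntegral.integral_congr hr.le fun z hz => ?_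
      rw [hK z (sphere_subset_closedBall hz) (hne z hz),
        sub_pow_mul_resolvent (hB z (sphere_subset_closedBall hz) (hne z hz))]
    rw [h1, h2]
    refine Complex.circleIntegral_eq_zero_of_differentiable_on_off_countable hr.le
      (Set.countable_singleton μ) (hKc.sub (by fun_prop)) fun z hz => ?_
    exact (hKd z hz.1 hz.2).sub (by fun_prop)
  have := finiteDimensional_ker_pow hker m
  refine Submodule.finiteDimensional_of_le (S₂ := LinearMap.ker ((N : H →ₗ[ℂ] H) ^ m)) ?_
  rintro _ ⟨x, rfl⟩
  have h3 : N ^ m * rieszProjection B μ r = 0 := by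
    rw [rieszProjection, mul_smul_comm, hzero, smul_zero]
  have h4 := DFunLike.congr_fun h3 x
  rw [LinearMap.mem_ker, ← ContinuousLinearMap.toLinearMap_pow]
  exact h4

theorem analyticAt_perturbationDet {μ : ℂ} (hμ : μ ∈ resolventSet ℂ A) :
    AnalyticAt ℂ (perturbationDet A e ψ) μ := by
  have : DifferentiableOn ℂ (perturbationDet A e ψ) (resolventSet ℂ A) := fun z hz => by
    have hR := (spectrum.hasDerivAt_resolvent_const_left hz).differentiableAt
    exact ((e.differentiableAt.comp z (hR.clm_apply (differentiableAt_const ψ))).const_sub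
      1).differentiableWithinAt
  exact this.analyticAt ((spectrum.isOpen_resolventSet A).mem_nhds hμ)

/-- At a zero, `(μ - A)⁻¹ ψ` is an eigenvector spanning the eigenspace. The zero has finite order
`m`, so by Sherman-Morrison the perturbed resolvent has a pole of order at most `m`. -/
theorem mem_discreteSpectrum_add_smulRight {μ : ℂ} (hμ : μ ∈ resolventSet ℂ A)
    (h0 : perturbationDet A e ψ μ = 0) (hne : ¬ ∀ᶠ z in 𝓝 μ, perturbationDet A e ψ z = 0) :
    μ ∈ discreteSpectrum (A + e.smulRight ψ) := by
  set B := A + e.smulRight ψ with hB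
  have hRm : (algebraMap ℂ (H →L[ℂ] H) μ - A) * resolvent A μ = 1 := Ring.mul_inverse_cancel _ hμ
  have hRm' : resolvent A μ * (algebraMap ℂ (H →L[ℂ] H) μ - A) = 1 :=
    Ring.inverse_mul_cancel _ hμ
  have heig : Module.End.HasEigenvalue (B : H →ₗ[ℂ] H) μ := by
    have he : e (resolvent A μ ψ) = 1 := by
      rw [perturbationDet, sub_eq_zero] at h0
      exact h0.symm
    refine Module.End.hasEigenvalue_of_hasEigenvector (x := resolvent A μ ψ) ⟨?_, ?_⟩
    · rw [Module.End.mem_eigenspace_iff]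
      have := DFunLike.congr_fun hRm ψ
      simp only [mul_apply_eq_comp, sub_apply,
        ContinuousLinearMap.algebraMap_apply, one_apply_eq_self] at this
      simp only [hB, ContinuousLinearMap.coe_coe, add_apply,
        ContinuousLinearMap.smulRight_apply, he, one_smul]
      rw [sub_eq_iff_eq_add] at this
      rw [this, add_comm]
    · intro h
      simp [h] at he
  have hker : FiniteDimensional ℂ
      (LinearMap.ker ((B - algebraMap ℂ _ μ : H →L[ℂ] H) : H →ₗ[ℂ] H)) := by
    refine Submodule.finiteDimensional_of_le (S₂ := ℂ ∙ resolvent A μ ψ) fun x hx => ?_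
    rw [Submodule.mem_span_singleton]
    refine ⟨e x, ?_⟩
    have h1 : (algebraMap ℂ (H →L[ℂ] H) μ - A) x = e x • ψ := by
      have hx : (B - algebraMap ℂ _ μ : H →L[ℂ] H) x = 0 := hx
      simp only [hB, sub_apply, add_apply,
        ContinuousLinearMap.smulRight_apply] at hx ⊢
      rw [sub_eq_zero] at hx
      rw [← hx]
      abel
    have h2 := DFunLike.congr_fun hRm' x
    rw [mul_apply_eq_comp, h1, map_smul] at h2
    exact h2
  obtain ⟨m, g, hg, hg0, hgD⟩ := (analyticAt_perturbationDet (e := e) (ψ := ψ)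
    hμ).exists_eventuallyEq_pow_smul_nonzero_iff.2 hne
  have hev : ∀ᶠ z in 𝓝 μ, z ∈ resolventSet ℂ A ∧
      perturbationDet A e ψ z = (z - μ) ^ m • g z ∧ g z ≠ 0 ∧ AnalyticAt ℂ g z :=
    ((spectrum.isOpen_resolventSet A).eventually_mem hμ).and
      (hgD.and ((hg.continuousAt.eventually_ne hg0).and hg.eventually_analyticAt))
  obtain ⟨r, hr, hball⟩ := (nhds_basis_closedBall (x := μ)).eventually_iff.1 hev
  have hBres : ∀ z ∈ closedBall μ r, z ≠ μ → z ∈ resolventSet ℂ B ∧ resolvent B z =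
      resolvent A z + (perturbationDet A e ψ z)⁻¹ •
        (resolvent A z * e.smulRight ψ * resolvent A z) := fun z hz hzμ => by
    obtain ⟨h1, h2, h3, -⟩ := hball hz
    refine resolvent_add_smulRight h1 ?_
    rw [h2]
    exact smul_ne_zero (pow_ne_zero _ (sub_ne_zero.2 hzμ)) h3
  refine ⟨heig, r, hr, ?_, ?_⟩
  · ext z
    simp only [Set.mem_inter_iff, Set.mem_singleton_iff]
    refine ⟨fun ⟨h1, h2⟩ => ?_, ?_⟩
    · by_contra hzμ
      exact h2 (hBres z h1 hzμ).1
    · rintro rfl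
      refine ⟨mem_closedBall_self hr.le, fun h => ?_⟩
      obtain ⟨x, hx, hx0⟩ := heig.exists_hasEigenvector
      rw [Module.End.mem_eigenspace_iff] at hx
      have hx' : B x = z • x := hx
      have h1 : resolvent B z * (algebraMap ℂ (H →L[ℂ] H) z - B) = 1 :=
        Ring.inverse_mul_cancel _ h
      have h2 := DFunLike.congr_fun h1 x
      rw [mul_apply_eq_comp, sub_apply, hx',
        ContinuousLinearMap.algebraMap_apply, sub_self, map_zero] at h2
      exact hx0 h2.symm
  -- With `(z - μ) ^ m` cancelled against the determinant `(z - μ) ^ m • g z`, only the nonvanishing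
  -- `g` is inverted.
  · have hKd : ∀ z ∈ closedBall μ r, DifferentiableAt ℂ (fun z => (z - μ) ^ m • resolvent A z +
        (g z)⁻¹ • (resolvent A z * e.smulRight ψ * resolvent A z)) z := fun z hz => by
      obtain ⟨h1, -, h3, h4⟩ := hball hz
      have hA := (spectrum.hasDerivAt_resolvent_const_left h1).differentiableAt
      have hg' := h4.differentiableAt.inv h3
      exact ((by fun_prop : DifferentiableAt ℂ (fun z : ℂ => (z - μ) ^ m) z).smul hA).add
        (hg'.smul ((hA.mul_const _).mul hA))
    refine finiteDimensional_range_rieszProjection hr (fun z h1 h2 => (hBres z h1 h2).1) hker m _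
      (fun z hz => (hKd z hz).continuousAt.continuousWithinAt)
      (fun z hz _ => hKd z (ball_subset_closedBall hz)) fun z hz hzμ => ?_
    rw [(hBres z hz hzμ).2, (hball hz).2.1, smul_add, smul_smul, smul_eq_mul, mul_inv,
      mul_inv_cancel_left₀ (pow_ne_zero _ (sub_ne_zero.2 hzμ))]

end RankOnePerturbation

/-! ### Bounded analytic functions and Blaschke products. -/

section BoundedAnalytic

open Metric Filter Topology Polynomial

/-- Parseval on the unit circle, for polynomials. -/
theorem sum_sq_norm_le_of_forall_eval_le {c : ℕ → ℂ} {N : ℕ} {C : ℝ}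
    (hC : ∀ w : ℂ, ‖w‖ = 1 → ‖∑ n ∈ Finset.range N, c n * w ^ n‖ ≤ C) :
    ∑ n ∈ Finset.range N, ‖c n‖ ^ 2 ≤ C ^ 2 := by
  set p : ℂ[X] := ∑ n ∈ Finset.range N, Polynomial.C (c n) * X ^ n with hp
  have hcoeff : ∀ n, p.coeff n = if n ∈ Finset.range N then c n else 0 := fun n => by
    simp only [hp, finsetSum_coeff, coeff_C_mul, coeff_X_pow, mul_ite, mul_one, mul_zero]
    rw [Finset.sum_ite_eq]
  have heval : ∀ w, p.eval w = ∑ n ∈ Finset.range N, c n * w ^ n := fun w => by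
    simp [hp, eval_finsetSum]
  calc ∑ n ∈ Finset.range N, ‖c n‖ ^ 2 = ∑ n ∈ Finset.range N, ‖p.coeff n‖ ^ 2 :=
        Finset.sum_congr rfl fun n hn => by rw [hcoeff n, if_pos hn]
    _ = ∑ n ∈ p.support, ‖p.coeff n‖ ^ 2 := by
        refine (Finset.sum_subset (fun n hn => ?_) fun n _ hn => ?_).symm
        · by_contra h
          rw [mem_support_iff, hcoeff, if_neg h] at hn
          exact hn rfl
        · rw [notMem_support_iff.1 hn, norm_zero, zero_pow two_ne_zero]
    _ ≤ C ^ 2 := by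
        rw [sum_sq_norm_coeff_eq_circleAverage]
        refine Real.circleAverage_mono_on_of_le_circle ?_ fun w hw => ?_
        · exact ContinuousOn.circleIntegrable' (by fun_prop)
        · have hw' : ‖w‖ = 1 := by simpa using hw
          have := hC w hw'
          rw [← heval] at this
          gcongr

/-- The Taylor coefficients of a bounded analytic function on the unit disc are square-summable. -/
theorem summable_sq_norm_of_bounded {a : ℕ → ℂ} {f : ℂ → ℂ} {C : ℝ}
    (hf : ∀ z ∈ ball (0 : ℂ) 1, HasSum (fun n => a n * z ^ n) (f z))
    (hC : ∀ z ∈ ball (0 : ℂ) 1, ‖f z‖ ≤ C) : Summable fun n => ‖a n‖ ^ 2 := by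
  -- On the circle of radius `r`, a partial sum is bounded by `C` plus a tail of the series; the
  -- tail is removed by `N → ∞`, and `r → 1` follows.
  have key : ∀ r : ℝ, 0 < r → r < 1 → ∀ K,
      ∑ n ∈ Finset.range K, ‖a n‖ ^ 2 * (r ^ n) ^ 2 ≤ C ^ 2 := by
    intro r hr hr1 K
    have hsum : Summable fun n => ‖a n‖ * r ^ n := by
      have := (hf r (by simpa [abs_of_pos hr] using hr1)).summable.norm
      simpa [abs_of_pos hr] using this
    have htail := tendsto_sum_nat_add fun n => ‖a n‖ * r ^ n
    have hbd : ∀ᶠ N in atTop, ∑ n ∈ Finset.range K, ‖a n‖ ^ 2 * (r ^ n) ^ 2 ≤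
        (C + ∑' n, ‖a (n + N)‖ * r ^ (n + N)) ^ 2 := by
      filter_upwards [eventually_ge_atTop K] with N hN
      calc ∑ n ∈ Finset.range K, ‖a n‖ ^ 2 * (r ^ n) ^ 2
          ≤ ∑ n ∈ Finset.range N, ‖a n‖ ^ 2 * (r ^ n) ^ 2 :=
            Finset.sum_le_sum_of_subset_of_nonneg (Finset.range_mono hN)
              fun _ _ _ => by positivity
        _ = ∑ n ∈ Finset.range N, ‖a n * r ^ n‖ ^ 2 :=
            Finset.sum_congr rfl fun n _ => by simp [mul_pow, abs_of_pos hr]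
        _ ≤ _ := by
            refine sum_sq_norm_le_of_forall_eval_le fun w hw => ?_
            have hz : (r * w : ℂ) ∈ ball (0 : ℂ) 1 := by simpa [hw, abs_of_pos hr] using hr1
            have h1 := hf _ hz
            have h2 : ∑ n ∈ Finset.range N, a n * r ^ n * w ^ n =
                f (r * w) - ∑' n, a (n + N) * (r * w) ^ (n + N) := by
              rw [← h1.tsum_eq, ← h1.summable.sum_add_tsum_nat_add N, add_sub_cancel_right]
              exact Finset.sum_congr rfl fun n _ => by rw [mul_pow, mul_assoc]
            rw [h2]
            refine (norm_sub_le _ _).trans (add_le_add (hC _ hz) ?_)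
            have h3 : ∀ n, ‖a (n + N) * (r * w : ℂ) ^ (n + N)‖ = ‖a (n + N)‖ * r ^ (n + N) :=
              fun n => by simp [hw, abs_of_pos hr]
            refine (norm_tsum_le_tsum_norm ?_).trans (tsum_congr h3).le
            simp_rw [h3]
            exact (summable_nat_add_iff N).2 hsum
    have hlim : Tendsto (fun N => (C + ∑' n, ‖a (n + N)‖ * r ^ (n + N)) ^ 2) atTop
        (𝓝 ((C + 0) ^ 2)) := (tendsto_const_nhds.add htail).pow 2
    rw [add_zero] at hlim
    exact ge_of_tendsto hlim hbd
  refine summable_of_sum_range_le (c := C ^ 2) (fun n => by positivity) fun K => ?_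
  have hlim : Tendsto (fun r : ℝ => ∑ n ∈ Finset.range K, ‖a n‖ ^ 2 * (r ^ n) ^ 2) (𝓝[<] 1)
      (𝓝 (∑ n ∈ Finset.range K, ‖a n‖ ^ 2 * ((1 : ℝ) ^ n) ^ 2)) :=
    tendsto_nhdsWithin_of_tendsto_nhds (Continuous.tendsto (by fun_prop) 1)
  simp only [one_pow, mul_one] at hlim
  refine le_of_tendsto hlim ?_
  filter_upwards [Ioo_mem_nhdsLT (show (0 : ℝ) < 1 by norm_num)] with r hr
  exact key r hr.1 hr.2 K

/-- The normalised Blaschke factor `(1 - w / a) / (1 - conj a * w)` minus one. -/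
noncomputable def blaschkeFactorSubOne (a w : ℂ) : ℂ :=
  (starRingEnd ℂ a - a⁻¹) * w / (1 - starRingEnd ℂ a * w)

theorem one_sub_norm_le_norm_one_sub {a w : ℂ} (ha : ‖a‖ < 1) :
    1 - ‖w‖ ≤ ‖1 - starRingEnd ℂ a * w‖ := by
  have h := norm_sub_norm_le (1 : ℂ) (starRingEnd ℂ a * w)
  rw [norm_one, norm_mul, RCLike.norm_conj] at h
  nlinarith [norm_nonneg w]

theorem one_sub_conj_mul_ne_zero {a w : ℂ} (ha : ‖a‖ < 1) (hw : ‖w‖ < 1) :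
    1 - starRingEnd ℂ a * w ≠ 0 := by
  rw [← norm_pos_iff]
  linarith [one_sub_norm_le_norm_one_sub (w := w) ha]

theorem one_add_blaschkeFactorSubOne {a w : ℂ} (h0 : a ≠ 0) (ha : ‖a‖ < 1) (hw : ‖w‖ < 1) :
    1 + blaschkeFactorSubOne a w = (a - w) / (1 - starRingEnd ℂ a * w) * a⁻¹ := by
  have := one_sub_conj_mul_ne_zero ha hw
  unfold blaschkeFactorSubOne
  field_simp
  ring

/-- A disc automorphism has modulus at most one, so only the normalisation `a⁻¹` costs. The form `1
+ (‖a‖⁻¹ - 1)` suits the exponential bound for products. -/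
theorem norm_one_add_blaschkeFactorSubOne_le {a w : ℂ} (h0 : a ≠ 0) (ha : ‖a‖ < 1)
    (hw : ‖w‖ < 1) : ‖1 + blaschkeFactorSubOne a w‖ ≤ 1 + (‖a‖⁻¹ - 1) := by
  rw [one_add_blaschkeFactorSubOne h0 ha hw, norm_mul, norm_inv, norm_div, add_sub_cancel]
  refine mul_le_of_le_one_left (by positivity) (div_le_one_of_le₀ ?_ (norm_nonneg _))
  refine le_of_sq_le_sq ?_ (norm_nonneg _)
  have h1 : ‖a‖ ^ 2 < 1 := by nlinarith [norm_nonneg a]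
  have h2 : ‖w‖ ^ 2 < 1 := by nlinarith [norm_nonneg w]
  rw [Complex.sq_norm, Complex.normSq_apply] at h1 h2 ⊢
  rw [Complex.sq_norm, Complex.normSq_apply]
  simp only [Complex.sub_re, Complex.sub_im, Complex.one_re, Complex.one_im, Complex.mul_re,
    Complex.mul_im, Complex.conj_re, Complex.conj_im]
  -- `|1 - conj a * w|² - |a - w|² = (1 - |a|²)(1 - |w|²)`.
  nlinarith [mul_pos (sub_pos.2 h1) (sub_pos.2 h2)]

theorem norm_blaschkeFactorSubOne_le {a w : ℂ} {R : ℝ} (h0 : a ≠ 0) (ha : ‖a‖ < 1)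
    (hw : ‖w‖ ≤ R) (hR : R < 1) :
    ‖blaschkeFactorSubOne a w‖ ≤ (‖a‖⁻¹ - 1) * (2 / (1 - R)) := by
  have hpos : 0 < ‖a‖ := norm_pos_iff.2 h0
  have hinv : 1 < ‖a‖⁻¹ := (one_lt_inv₀ hpos).2 ha
  have h1 : ‖starRingEnd ℂ a - a⁻¹‖ ≤ 2 * (‖a‖⁻¹ - 1) := by
    have : starRingEnd ℂ a - a⁻¹ = (((‖a‖ ^ 2 - 1 : ℝ)) : ℂ) * a⁻¹ := by
      rw [Complex.ofReal_sub, Complex.ofReal_pow, ← Complex.mul_conj']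
      field_simp
      push_cast
      ring
    rw [this, norm_mul, norm_inv, Complex.norm_real, Real.norm_eq_abs,
      abs_of_nonpos (by nlinarith)]
    have h2 : ‖a‖ * ‖a‖⁻¹ = 1 := mul_inv_cancel₀ hpos.ne'
    have : -(‖a‖ ^ 2 - 1) * ‖a‖⁻¹ = (1 + ‖a‖) * (‖a‖⁻¹ - 1) := by
      linear_combination (-‖a‖) * h2 - h2
    rw [this]
    nlinarith
  have h3 := one_sub_norm_le_norm_one_sub (w := w) ha
  rw [blaschkeFactorSubOne, norm_div, norm_mul, ← mul_div_assoc]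
  refine div_le_div₀ (by nlinarith) ?_ (by linarith) (by linarith)
  have : ‖w‖ ≤ 1 := by linarith
  nlinarith [norm_nonneg (starRingEnd ℂ a - a⁻¹), norm_nonneg w]

theorem summable_norm_inv_sub_one {z : ℕ → ℂ} (h0 : ∀ k, z k ≠ 0)
    (hs : Summable fun k => 1 - ‖z k‖) : Summable fun k => ‖z k‖⁻¹ - 1 := by
  have hev : ∀ᶠ k in atTop, 1 - ‖z k‖ < 1 / 2 :=
    hs.tendsto_atTop_zero.eventually_lt_const (by norm_num)
  have hev' : ∀ᶠ k in cofinite, ‖‖z k‖⁻¹ - 1‖ ≤ 2 * |1 - ‖z k‖| := by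
    rw [Nat.cofinite_eq_atTop]
    filter_upwards [hev] with k hk
    have hpos : 0 < ‖z k‖ := norm_pos_iff.2 (h0 k)
    have : ‖z k‖⁻¹ - 1 = ‖z k‖⁻¹ * (1 - ‖z k‖) := by field_simp
    rw [this, norm_mul, Real.norm_eq_abs, Real.norm_eq_abs]
    refine mul_le_mul_of_nonneg_right ?_ (abs_nonneg _)
    rw [abs_of_pos (by positivity), inv_le_comm₀ hpos (by norm_num)]
    linarith
  exact (hs.abs.mul_left 2).of_norm_bounded_eventually hev'

/-- Blaschke: a sequence in the punctured unit disc with `∑ (1 - |z k|) < ∞` is contained in the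
zero set of a bounded analytic function that equals `1` at the origin. -/
theorem exists_bounded_analytic_vanishing {z : ℕ → ℂ} (h0 : ∀ k, z k ≠ 0) (h1 : ∀ k, ‖z k‖ < 1)
    (hs : Summable fun k => 1 - ‖z k‖) :
    ∃ (b : ℂ → ℂ) (C : ℝ), DifferentiableOn ℂ b (ball 0 1) ∧ (∀ w ∈ ball (0 : ℂ) 1, ‖b w‖ ≤ C) ∧
      b 0 = 1 ∧ ∀ k, b (z k) = 0 := by
  have hw := summable_norm_inv_sub_one h0 hs
  have hw0 : ∀ k, 0 ≤ ‖z k‖⁻¹ - 1 := fun k =>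
    sub_nonneg.2 (one_le_inv_iff₀.2 ⟨norm_pos_iff.2 (h0 k), (h1 k).le⟩)
  have hdiff : ∀ k, DifferentiableOn ℂ (blaschkeFactorSubOne (z k)) (ball 0 1) := fun k w hw => by
    have := one_sub_conj_mul_ne_zero (h1 k) (mem_ball_zero_iff.1 hw)
    have hnum : DifferentiableAt ℂ (fun w => (starRingEnd ℂ (z k) - (z k)⁻¹) * w) w := by fun_prop
    have hden : DifferentiableAt ℂ (fun w => 1 - starRingEnd ℂ (z k) * w) w := by fun_prop
    exact (hnum.div hden this).differentiableWithinAt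
  -- The majorant degenerates as `R → 1`, hence the smaller discs.
  have hprod : ∀ R < 1, HasProdLocallyUniformlyOn (fun k w => 1 + blaschkeFactorSubOne (z k) w)
      (fun w => ∏' k, (1 + blaschkeFactorSubOne (z k) w)) (ball 0 R) := fun R hR =>
    Summable.hasProdLocallyUniformlyOn_one_add isOpen_ball (hw.mul_right (2 / (1 - R)))
      (.of_forall fun k w hw => norm_blaschkeFactorSubOne_le (h0 k) (h1 k)
        (mem_ball_zero_iff.1 hw).le hR)
      fun k => ((hdiff k).mono (ball_subset_ball hR.le)).continuousOn
  refine ⟨fun w => ∏' k, (1 + blaschkeFactorSubOne (z k) w), Real.exp (∑' k, (‖z k‖⁻¹ - 1)),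
    fun w hw => ?_, fun w hw1 => ?_, ?_, fun k => ?_⟩
  · obtain ⟨R, hwR, hR⟩ := exists_between (mem_ball_zero_iff.1 hw)
    have hd : DifferentiableOn ℂ (fun w => ∏' k, (1 + blaschkeFactorSubOne (z k) w))
        (ball 0 R) := (hprod R hR).differentiableOn
      (.of_forall fun s => by
        have := DifferentiableOn.finsetProd (u := s) (s := ball (0 : ℂ) R)
          (f := fun k w => 1 + blaschkeFactorSubOne (z k) w) fun k _ =>
          ((hdiff k).mono (ball_subset_ball hR.le)).const_add 1
        simpa [Finset.prod_fn] using this) isOpen_ball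
    exact (hd.differentiableAt
      (isOpen_ball.mem_nhds (mem_ball_zero_iff.2 hwR))).differentiableWithinAt
  · obtain ⟨R, hwR, hR⟩ := exists_between (mem_ball_zero_iff.1 hw1)
    have := ((hprod R hR).hasProd (mem_ball_zero_iff.2 hwR)).norm
    refine le_of_tendsto this (.of_forall fun s => ?_)
    calc ∏ k ∈ s, ‖1 + blaschkeFactorSubOne (z k) w‖ ≤ ∏ k ∈ s, (1 + (‖z k‖⁻¹ - 1)) :=
          Finset.prod_le_prod (fun _ _ => norm_nonneg _) fun k _ =>
            norm_one_add_blaschkeFactorSubOne_le (h0 k) (h1 k) (mem_ball_zero_iff.1 hw1)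
      _ ≤ Real.exp (∑ k ∈ s, (‖z k‖⁻¹ - 1)) := Real.prod_one_add_le_exp_sum _ hw0
      _ ≤ _ := Real.exp_le_exp.2 (hw.sum_le_tsum _ fun k _ => hw0 k)
  · simp [blaschkeFactorSubOne]
  · refine tprod_of_exists_eq_zero ⟨k, ?_⟩
    rw [one_add_blaschkeFactorSubOne (h0 k) (h1 k) (h1 k), sub_self, zero_div, zero_mul]

end BoundedAnalytic

/-! ### The Joukowski map and the Blaschke condition. -/

section Joukowski

open Metric Filter Topology

/-- The roots of `y² - l y + 1` are mutually inverse; were they on the unit circle, `l = 2 Re y`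
would lie in the band. -/
theorem exists_joukowski_preimage {l : ℂ} (hl : l ∉ bandInterval) :
    ∃ z : ℂ, z ≠ 0 ∧ ‖z‖ < 1 ∧ l = z + z⁻¹ := by
  obtain ⟨s, hs⟩ := IsAlgClosed.exists_pow_nat_eq (l ^ 2 - 4) (n := 2) (by norm_num)
  set y : ℂ := (l - s) / 2 with hy
  have hprod : y * ((l + s) / 2) = 1 := by
    rw [hy]
    linear_combination (-1 / 4) * hs
  have hy0 : y ≠ 0 := left_ne_zero_of_mul_eq_one hprod
  have hinv : y⁻¹ = (l + s) / 2 := inv_eq_of_mul_eq_one_right hprod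
  have hsum : l = y + y⁻¹ := by rw [hinv, hy]; ring
  rcases lt_trichotomy ‖y‖ 1 with h | h | h
  · exact ⟨y, hy0, h, hsum⟩
  · refine absurd ⟨2 * y.re, ?_, ?_⟩ hl
    · have := abs_le.1 (h ▸ Complex.abs_re_le_norm y)
      constructor <;> linarith
    · rw [hsum, Complex.inv_eq_conj h, Complex.add_conj]
  · exact ⟨y⁻¹, inv_ne_zero hy0, by rw [norm_inv]; exact inv_lt_one_of_one_lt₀ h,
      by rw [inv_inv, add_comm]; exact hsum⟩

/-- Write `t = w + conj w` with `|w| = 1`. The distance to `t` times `|z|` is `|z - w| |z - conj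
w|`: each factor is at least `1 - |z|`, and the larger is at least half their sum, which dominates
`|z - z⁻¹| |z|`. -/
theorem one_sub_norm_mul_le_infDist {z : ℂ} (h0 : z ≠ 0) (h1 : ‖z‖ < 1) :
    (1 - ‖z‖) / 2 * ‖z - z⁻¹‖ ≤ infDist (z + z⁻¹) bandInterval := by
  have hne : bandInterval.Nonempty :=
    ⟨_, Set.mem_image_of_mem _ (Set.left_mem_Icc.2 (by norm_num))⟩
  rw [le_infDist hne]
  rintro _ ⟨t, ⟨ht1, ht2⟩, rfl⟩
  set w : ℂ := ⟨t / 2, √(1 - (t / 2) ^ 2)⟩ with hw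
  have hsq : √(1 - (t / 2) ^ 2) ^ 2 = 1 - (t / 2) ^ 2 := Real.sq_sqrt (by nlinarith)
  have hw1 : w * starRingEnd ℂ w = 1 := by
    rw [Complex.mul_conj, Complex.normSq_apply]
    norm_cast
    rw [hw]
    simp only
    linarith
  have hwn : ‖w‖ = 1 := by
    rw [← sq_eq_sq₀ (norm_nonneg _) zero_le_one, Complex.sq_norm, Complex.normSq_apply]
    simp only [hw]
    linarith
  have hadd : w + starRingEnd ℂ w = t := by
    rw [Complex.add_conj]
    simp only [hw]
    push_cast
    ring
  have hz : 0 < ‖z‖ := norm_pos_iff.2 h0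
  have hdist : dist (z + z⁻¹) (t : ℂ) * ‖z‖ = ‖z - w‖ * ‖z - starRingEnd ℂ w‖ := by
    rw [dist_eq_norm, ← norm_mul, ← norm_mul]
    congr 1
    rw [← hadd]
    field_simp
    linear_combination -hw1
  have hdiff : ‖z - z⁻¹‖ * ‖z‖ ≤ ‖z - w‖ + ‖z - starRingEnd ℂ w‖ := by
    have : (z - z⁻¹) * z = (z - w) * starRingEnd ℂ w + z * (z - starRingEnd ℂ w) := by
      field_simp
      linear_combination hw1
    rw [← norm_mul, this]
    refine (norm_add_le _ _).trans ?_
    rw [norm_mul, norm_mul, RCLike.norm_conj, hwn]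
    nlinarith [norm_nonneg (z - starRingEnd ℂ w)]
  have hb1 : 1 - ‖z‖ ≤ ‖z - w‖ := by
    rw [norm_sub_rev, ← hwn]; exact norm_sub_norm_le w z
  have hb2 : 1 - ‖z‖ ≤ ‖z - starRingEnd ℂ w‖ := by
    rw [norm_sub_rev, ← hwn, ← RCLike.norm_conj w]; exact norm_sub_norm_le _ z
  refine le_of_mul_le_mul_right ?_ hz
  rw [hdist]
  nlinarith

theorem one_sub_norm_le_of_joukowski {z : ℂ} (h0 : z ≠ 0) (h1 : ‖z‖ < 1) :
    1 - ‖z‖ ≤ 2 * (infDist (z + z⁻¹) bandInterval /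
      (‖z + z⁻¹ + 2‖ ^ (1 / 2 : ℝ) * ‖z + z⁻¹ - 2‖ ^ (1 / 2 : ℝ))) := by
  have hden : ‖z + z⁻¹ + 2‖ ^ (1 / 2 : ℝ) * ‖z + z⁻¹ - 2‖ ^ (1 / 2 : ℝ) = ‖z - z⁻¹‖ := by
    rw [← Real.mul_rpow (norm_nonneg _) (norm_nonneg _), ← norm_mul, ← Real.sqrt_eq_rpow]
    have : (z + z⁻¹ + 2) * (z + z⁻¹ - 2) = (z - z⁻¹) ^ 2 := by
      field_simp
      ring
    rw [this, norm_pow, Real.sqrt_sq (norm_nonneg _)]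
  have hpos : 0 < ‖z - z⁻¹‖ := by
    rw [norm_pos_iff, sub_ne_zero]
    intro h
    have h2 : ‖z‖ * ‖z‖ = 1 := by
      rw [← norm_mul]
      nth_rw 2 [h]
      rw [mul_inv_cancel₀ h0, norm_one]
    nlinarith [norm_nonneg z]
  rw [hden, ← mul_div_assoc, le_div_iff₀ hpos]
  linarith [one_sub_norm_mul_le_infDist h0 h1]

end Joukowski

/-! ### The free resolvent and the perturbation determinant. -/

section FreeResolvent

open Filter Topology

/-- `z + z⁻¹ - A = z⁻¹ (1 - z S⁻¹)(1 - z S)` with `S` the shift; both factors are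
Neumann-invertible. -/
theorem joukowski_mem_resolventSet {z : ℂ} (h0 : z ≠ 0) (h1 : ‖z‖ < 1) :
    z + z⁻¹ ∈ resolventSet ℂ freeSchrodinger := by
  have hunit : ∀ a : ℤ, IsUnit (1 - z • (shiftBy a).toContinuousLinearMap) := fun a => by
    refine isUnit_one_sub_of_norm_lt_one ?_
    rw [norm_smul]
    have := (shiftBy a).norm_toContinuousLinearMap_le
    nlinarith [norm_nonneg z]
  have hmul : (shiftBy (-1)).toContinuousLinearMap * (shiftBy 1).toContinuousLinearMap = 1 := by
    ext u k
    change (u : ℤ → ℂ) (k + -1 + 1) = (u : ℤ → ℂ) k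
    rw [neg_add_cancel_right]
  have hfact : algebraMap ℂ (EllTwoZ →L[ℂ] EllTwoZ) (z + z⁻¹) - freeSchrodinger =
      (Units.mk0 z h0)⁻¹ • ((1 - z • (shiftBy (-1)).toContinuousLinearMap) *
        (1 - z • (shiftBy 1).toContinuousLinearMap)) := by
    rw [Units.smul_def, Units.val_inv_eq_inv_val, Units.val_mk0, mul_sub, sub_mul, sub_mul,
      smul_mul_smul_comm, hmul, freeSchrodinger, Algebra.algebraMap_eq_smul_one, one_mul, mul_one,
      one_mul, smul_sub, smul_sub, smul_sub, smul_smul, smul_smul, smul_smul, inv_mul_cancel₀ h0,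
      inv_mul_cancel_left₀ h0, add_smul, one_smul, one_smul]
    abel
  rw [spectrum.mem_resolventSet_iff, hfact]
  exact ((hunit _).mul (hunit _)).smul _

theorem summable_pow_natAbs_mul {z : ℂ} (h1 : ‖z‖ < 1) (v : EllTwoZ) (a c : ℤ) :
    Summable fun n : ℤ => z ^ (n + a).natAbs * (v : ℤ → ℂ) (n + c) := by
  have h := summable_geometric_of_lt_one (norm_nonneg z) h1
  have hgeom : Summable fun n : ℤ => ‖z‖ ^ n.natAbs :=
    Summable.of_nat_of_neg h (h.congr fun n => by rw [Int.natAbs_neg, Int.natAbs_natCast])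
  have hgeom' : Summable fun n : ℤ => ‖z‖ ^ (n + a).natAbs := by
    simpa only [Function.comp_def] using hgeom.comp_injective (add_left_injective a)
  refine (hgeom'.mul_right ‖v‖).of_norm_bounded fun n => ?_
  have hv : ‖(v : ℤ → ℂ) (n + c)‖ ≤ ‖v‖ := lp.norm_apply_le_norm two_ne_zero v _
  rw [norm_mul, norm_pow]
  exact mul_le_mul_of_nonneg_left hv (pow_nonneg (norm_nonneg z) _)

theorem tsum_pow_natAbs_mul_shift (z : ℂ) (v : EllTwoZ) (c : ℤ) :
    ∑' n : ℤ, z ^ n.natAbs * (v : ℤ → ℂ) (n + c) =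
      ∑' n : ℤ, z ^ (n - c).natAbs * (v : ℤ → ℂ) n := by
  rw [← (Equiv.addRight c).tsum_eq fun n => z ^ (n - c).natAbs * (v : ℤ → ℂ) n]
  simp

theorem tsum_pow_natAbs_mul_shift_add {z : ℂ} (h1 : ‖z‖ < 1) (v : EllTwoZ) (s : ℂ) :
    ∑' n : ℤ, z ^ n.natAbs * ((v : ℤ → ℂ) (n + -1) + s * (v : ℤ → ℂ) (n + 1)) =
      ∑' n : ℤ, (z ^ (n + 1).natAbs + s * z ^ (n + -1).natAbs) * (v : ℤ → ℂ) n := by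
  have h (a c : ℤ) := summable_pow_natAbs_mul h1 v a c
  have e1 := h 0 (-1)
  have e2 := (h 0 1).mul_left s
  have e3 := h 1 0
  have e4 := (h (-1) 0).mul_left s
  simp only [add_zero] at e1 e2 e3 e4
  calc _ = ∑' n : ℤ, (z ^ n.natAbs * (v : ℤ → ℂ) (n + -1) +
        s * (z ^ n.natAbs * (v : ℤ → ℂ) (n + 1))) := tsum_congr fun n => by ring
    _ = ∑' n : ℤ, (z ^ (n + 1).natAbs * (v : ℤ → ℂ) n +
        s * (z ^ (n + -1).natAbs * (v : ℤ → ℂ) n)) := by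
      rw [e1.tsum_add e2, e3.tsum_add e4, tsum_mul_left, tsum_mul_left,
        tsum_pow_natAbs_mul_shift, tsum_pow_natAbs_mul_shift]
      simp only [sub_neg_eq_add, ← sub_eq_add_neg]
    _ = _ := tsum_congr fun n => by ring

/-- The value at `0` of the solution `v` of `(z + z⁻¹ - A) v = α(· - 1) - α(· + 1)`, for `α`
supported on the positive integers. -/
theorem apply_zero_of_sub_freeSchrodinger_eq {z : ℂ} (h0 : z ≠ 0) (h1 : ‖z‖ < 1)
    {v α : EllTwoZ} (hα : ∀ n : ℤ, n ≤ 0 → (α : ℤ → ℂ) n = 0)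
    (hv : (z + z⁻¹) • v - freeSchrodinger v = shiftBy (-1) α - shiftBy 1 α) :
    (v : ℤ → ℂ) 0 = -∑' n : ℤ, z ^ n.natAbs * (α : ℤ → ℂ) n := by
  have hpt : ∀ n : ℤ, (z + z⁻¹) * (v : ℤ → ℂ) n -
      ((v : ℤ → ℂ) (n + -1) + 1 * (v : ℤ → ℂ) (n + 1)) =
      (α : ℤ → ℂ) (n + -1) + (-1) * (α : ℤ → ℂ) (n + 1) := fun n => by
    have := congrArg (fun u : EllTwoZ => (u : ℤ → ℂ) n) hv
    rw [one_mul, neg_one_mul, ← sub_eq_add_neg]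
    exact this
  have hzz : z⁻¹ - z ≠ 0 := by
    rw [sub_ne_zero]
    intro h
    have h2 : ‖z‖ * ‖z‖ = 1 := by
      rw [← norm_mul]
      nth_rw 1 [← h]
      rw [inv_mul_cancel₀ h0, norm_one]
    nlinarith [norm_nonneg z]
  have hs (a c : ℤ) := summable_pow_natAbs_mul h1 v a c
  have e0 := (hs 0 0).mul_left (z + z⁻¹)
  have e1 := hs 0 (-1)
  have e2 := hs 0 1
  have e3 := hs 1 0
  have e4 := hs (-1) 0
  simp only [add_zero] at e0 e1 e2 e3 e4
  -- `z ^ |n|` is the unnormalised Green function: applying `z + z⁻¹ - A` to it leaves `z⁻¹ - z` at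
  -- `0` and nothing elsewhere.
  have hleft : ∑' n : ℤ, z ^ n.natAbs * ((z + z⁻¹) * (v : ℤ → ℂ) n -
      ((v : ℤ → ℂ) (n + -1) + 1 * (v : ℤ → ℂ) (n + 1))) = (z⁻¹ - z) * (v : ℤ → ℂ) 0 := by
    calc _ = ∑' n : ℤ, (z + z⁻¹) * (z ^ n.natAbs * (v : ℤ → ℂ) n) - ∑' n : ℤ, z ^ n.natAbs *
          ((v : ℤ → ℂ) (n + -1) + 1 * (v : ℤ → ℂ) (n + 1)) := by
          rw [← e0.tsum_sub]
          · exact tsum_congr fun n => by ring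
          · exact (e1.add e2).congr fun n => by ring
      _ = ∑' n : ℤ, ((z + z⁻¹) * z ^ n.natAbs - z ^ (n + 1).natAbs - z ^ (n + -1).natAbs) *
          (v : ℤ → ℂ) n := by
          rw [tsum_pow_natAbs_mul_shift_add h1, ← e0.tsum_sub]
          · exact tsum_congr fun n => by ring
          · exact (e3.add e4).congr fun n => by ring
      _ = _ := by
          rw [tsum_eq_single 0]
          · norm_num
          · intro n hn
            refine mul_eq_zero_of_left ?_ _
            rcases lt_or_gt_of_ne hn with h | h
            · obtain ⟨m, rfl⟩ : ∃ m : ℕ, n = -((m : ℤ) + 1) := ⟨(-n - 1).toNat, by omega⟩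
              rw [show (-((m : ℤ) + 1)).natAbs = m + 1 by omega,
                show (-((m : ℤ) + 1) + 1).natAbs = m by omega,
                show (-((m : ℤ) + 1) + -1).natAbs = m + 2 by omega]
              field_simp
              ring
            · obtain ⟨m, rfl⟩ : ∃ m : ℕ, n = (m : ℤ) + 1 := ⟨(n - 1).toNat, by omega⟩
              rw [show ((m : ℤ) + 1).natAbs = m + 1 by omega,
                show ((m : ℤ) + 1 + 1).natAbs = m + 2 by omega,
                show ((m : ℤ) + 1 + -1).natAbs = m by omega]
              field_simp
              ring
  -- For `n ≥ 1`, `z ^ (n + 1) - z ^ (n - 1) = (z - z⁻¹) z ^ n`; the sign would flip for `n < 0`,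
  -- hence the support condition on `α`.
  have hright : ∑' n : ℤ, z ^ n.natAbs * ((α : ℤ → ℂ) (n + -1) + (-1) * (α : ℤ → ℂ) (n + 1)) =
      (z - z⁻¹) * ∑' n : ℤ, z ^ n.natAbs * (α : ℤ → ℂ) n := by
    rw [tsum_pow_natAbs_mul_shift_add h1, ← tsum_mul_left]
    refine tsum_congr fun n => ?_
    rcases le_or_gt n 0 with h | h
    · rw [hα n h]
      simp
    · obtain ⟨m, rfl⟩ : ∃ m : ℕ, n = (m : ℤ) + 1 := ⟨(n - 1).toNat, by omega⟩
      rw [show ((m : ℤ) + 1).natAbs = m + 1 by omega,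
        show ((m : ℤ) + 1 + 1).natAbs = m + 2 by omega,
        show ((m : ℤ) + 1 + -1).natAbs = m by omega]
      field_simp
      ring
  simp_rw [hpt] at hleft
  rw [hright] at hleft
  refine mul_left_cancel₀ hzz ?_
  rw [← hleft]
  ring

theorem perturbationDet_freeSchrodinger {z : ℂ} (h0 : z ≠ 0) (h1 : ‖z‖ < 1)
    {α : EllTwoZ} (hα : ∀ n : ℤ, n ≤ 0 → (α : ℤ → ℂ) n = 0) :
    perturbationDet freeSchrodinger (lp.evalCLM ℂ (fun _ : ℤ => ℂ) 2 0)
      (shiftBy (-1) α - shiftBy 1 α) (z + z⁻¹) = 1 + ∑' n : ℤ, z ^ n.natAbs * (α : ℤ → ℂ) n := by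
  set ψ : EllTwoZ := shiftBy (-1) α - shiftBy 1 α
  have h := DFunLike.congr_fun (Ring.mul_inverse_cancel _ (joukowski_mem_resolventSet h0 h1)) ψ
  have h2 := apply_zero_of_sub_freeSchrodinger_eq h0 h1 hα
    (v := resolvent freeSchrodinger (z + z⁻¹) ψ) h
  rw [perturbationDet]
  change 1 - (resolvent freeSchrodinger (z + z⁻¹) ψ : ℤ → ℂ) 0 = _
  rw [h2, sub_neg_eq_add]

/-- Extension of a square-summable sequence on the positive integers by zero. -/
theorem exists_ellTwoZ_of_summable {a : ℕ → ℂ} (ha : Summable fun n => ‖a n‖ ^ 2) :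
    ∃ α : EllTwoZ, (∀ n : ℤ, n ≤ 0 → (α : ℤ → ℂ) n = 0) ∧
      ∀ n : ℕ, (α : ℤ → ℂ) (n + 1) = a (n + 1) := by
  let f : ℤ → ℂ := fun n => if 0 < n then a n.natAbs else 0
  have hneg : ∀ n : ℤ, n ≤ 0 → f n = 0 := fun n hn => if_neg hn.not_gt
  have hpos : ∀ n : ℕ, f (n + 1) = a (n + 1) := fun n => by
    simp only [f]
    rw [if_pos (by omega), show ((n : ℤ) + 1).natAbs = n + 1 by omega]
  have hf : Memℓp f 2 := by
    refine memℓp_gen (Summable.of_nat_of_neg_add_one ?_ ?_)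
    · rw [← summable_nat_add_iff 1]
      refine ((summable_nat_add_iff 1).2 ha).congr fun n => ?_
      rw [Nat.cast_add, Nat.cast_one, hpos]
      norm_num
    · refine summable_zero.congr fun n => ?_
      rw [hneg _ (by omega)]
      norm_num
  exact ⟨⟨f, hf⟩, hneg, hpos⟩

end FreeResolvent

/-! ### Assembly. -/

open Metric Topology in
theorem proposition6p1 (lam : ℕ → ℂ) (hlam : ∀ k, lam k ∉ bandInterval)
    (hsum : Summable fun k : ℕ =>
      Metric.infDist (lam k) bandInterval /
        (‖lam k + 2‖ ^ (1 / 2 : ℝ) * ‖lam k - 2‖ ^ (1 / 2 : ℝ))) :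
    ∃ M : EllTwoZ →L[ℂ] EllTwoZ,
      Module.finrank ℂ (LinearMap.range (M : EllTwoZ →ₗ[ℂ] EllTwoZ)) = 1 ∧
      ∀ k, lam k ∈ discreteSpectrum (freeSchrodinger + M) := by
  choose z hz0 hz1 hz using fun k => exists_joukowski_preimage (hlam k)
  have hbl : Summable fun k => 1 - ‖z k‖ := by
    refine (hsum.mul_left 2).of_nonneg_of_le (fun k => by linarith [hz1 k]) fun k => ?_
    rw [hz k]
    exact one_sub_norm_le_of_joukowski (hz0 k) (hz1 k)
  obtain ⟨b, C, hb, hbC, hb0, hbz⟩ := exists_bounded_analytic_vanishing hz0 hz1 hbl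
  obtain ⟨a, ha⟩ : ∃ a : ℕ → ℂ, ∀ w ∈ ball (0 : ℂ) 1, HasSum (fun n => a n * w ^ n) (b w) :=
    ⟨fun n => (n.factorial : ℂ)⁻¹ * iteratedDeriv n b 0, fun w hw => by
      refine (Complex.hasSum_taylorSeries_on_ball hb hw).congr_fun fun n => ?_
      rw [sub_zero, smul_eq_mul, smul_eq_mul, mul_assoc, mul_comm (w ^ n)]⟩
  have ha0 : a 0 = 1 := by
    have h := ha 0 (by simp)
    rw [hb0] at h
    have h' := hasSum_single (f := fun n => a n * (0 : ℂ) ^ n) 0 fun n hn => by simp [hn]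
    simpa using h'.unique h
  obtain ⟨α, hα, hαa⟩ := exists_ellTwoZ_of_summable (summable_sq_norm_of_bounded ha hbC)
  set e : EllTwoZ →L[ℂ] ℂ := lp.evalCLM ℂ (fun _ : ℤ => ℂ) 2 0
  set ψ : EllTwoZ := shiftBy (-1) α - shiftBy 1 α with hψ
  have hdet : ∀ w : ℂ, w ≠ 0 → ‖w‖ < 1 →
      perturbationDet freeSchrodinger e ψ (w + w⁻¹) = b w := fun w hw0 hw1 => by
    have hbw := ha w (mem_ball_zero_iff.2 hw1)
    have hinj : Function.Injective fun n : ℕ => (n : ℤ) + 1 := fun m n h => by simpa using h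
    rw [perturbationDet_freeSchrodinger hw0 hw1 hα, ← hbw.tsum_eq, hbw.summable.tsum_eq_zero_add,
      ha0, pow_zero, one_mul, ← hinj.tsum_eq]
    · congr 1
      refine tsum_congr fun n => ?_
      rw [hαa, show ((n : ℤ) + 1).natAbs = n + 1 by omega, mul_comm]
    · intro n hn
      rw [Function.mem_support] at hn
      by_contra hn'
      refine hn ?_
      rw [hα n, mul_zero]
      by_contra h
      exact hn' ⟨(n - 1).toNat, by change (((n - 1).toNat : ℕ) : ℤ) + 1 = n; omega⟩
  have hzero : ∀ k, perturbationDet freeSchrodinger e ψ (lam k) = 0 := fun k => by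
    rw [hz k, hdet _ (hz0 k) (hz1 k), hbz]
  -- If `e` or `ψ` vanished, the determinant would be constantly `1`, without zeros.
  have he0 : e ≠ 0 := fun h => by
    have := hzero 0
    simp [perturbationDet, h] at this
  have hψ0 : ψ ≠ 0 := fun h => by
    have := hzero 0
    simp [perturbationDet, h] at this
  refine ⟨e.smulRight ψ, ?_, fun k => ?_⟩
  · rw [ContinuousLinearMap.range_smulRight_apply he0]
    exact finrank_span_singleton hψ0
  · refine mem_discreteSpectrum_add_smulRight (by
      -- Local vanishing of the determinant at `lam k` pulls back to vanishing of `b` near `z k`,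
      -- hence on the whole disc, against `b 0 = 1`.
      rw [hz k]; exact joukowski_mem_resolventSet (hz0 k) (hz1 k)) (hzero k) fun hev => ?_
    have hcont : ContinuousAt (fun w : ℂ => w + w⁻¹) (z k) :=
      continuousAt_id.add (continuousAt_inv₀ (hz0 k))
    have hmem : z k ∈ ball (0 : ℂ) 1 := mem_ball_zero_iff.2 (hz1 k)
    rw [hz k] at hev
    have hbev : b =ᶠ[𝓝 (z k)] 0 := by
      filter_upwards [hcont.eventually hev, isOpen_ball.mem_nhds hmem,
        isOpen_ne.mem_nhds (hz0 k)] with w h1 h2 h3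
      rw [← hdet w h3 (mem_ball_zero_iff.1 h2), h1]
      rfl
    have := (hb.analyticOnNhd isOpen_ball).eqOn_zero_of_preconnected_of_eventuallyEq_zero
      (convex_ball 0 1).isPreconnected hmem hbev (mem_ball_self zero_lt_one)
    rw [hb0] at this
    exact one_ne_zero this
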